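/- Let $a,b>0$ be real numbers with $ab<a+b$. Let $F(a,b;c;x)=\sum_{n\ge 0}\frac{(a)_n(b)_n}{(c)_n\,n!}x^n$ ($|x|<1$) be the Gaussian hypergeometric function, where $(a)_n=a(a+1)\cdots(a+n-1)$ and $(a)_0=1$. Let $B=B(a,b)=\Gamma(a)\Gamma(b)/\Gamma(a+b)$ and $R=R(a,b)=-2\gamma-\Psi(a)-\Psi(b)$, where $\Psi=\Gamma'/\Gamma$ and $\gamma$ is the Euler–Mascheroni constant. Define $P:\mathbb R\to\mathbb R$ by $$P(t)=F\Big(a,b;a+b;\frac{e^t}{1+e^t}\Big)\,F\Big(a,b;a+b;\frac{1}{1+e^t}\Big).$$ Then the following hold. (1) $P$ is even, strictly decreasing on $(-\infty,0]$ and strictly increasing on $[0,\infty)$; $P$ is twice differentiable with $P''(t)>0$ for all $t\in\mathbb R$, and $P$ is strictly convex on $\mathbb R$. Moreover, $$P(t)=\frac{|t|+R}{B}+O\big(|t|e^{-|t|}\big)\quad\text{as } t\to+\infty\text{ and as }t\to-\infty.$$ (2) $P'$ is odd and strictly increasing on $\mathbb R$, $P'(0)=0$, and $$P'(t)=\frac{|t|}{t}\cdot\frac1B+O\big(|t|e^{-|t|}\big)\quad\text{as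 } t\to+\infty\text{ and as }t\to-\infty.$$ Moreover $-1/B<P'(t)<1/B$ for all $t\in\mathbb R$, and these bounds are sharp: $\inf_{\mathbb R}P'=-1/B$ and $\sup_{\mathbb R}P'=1/B$. (3) On $\mathbb R$, the function $P(t)-t/B$ is strictly convex and strictly decreasing, and the function $P(t)+t/B$ is strictly convex and strictly increasing. Moreover $$\frac{R}{B}<P(t)-\frac{|t|}{B}\le P(0)\qquad\text{for all }t\in\mathbb R,$$ and these bounds are sharp: the infimum and the supremum over $t\in\mathbb R$ of $P(t)-|t|/B$ are $R/B$ and $P(0)$, respectively. (4) The function $G(t)=(P(t)-P(0))/t$ for $t\ne0$, extended to $t=0$ by $G(0)=P'(0)=0$, is strictly increasing on $\mathbb R$ and maps $\mathbb R$ onto the open interval $(-1/B,1/B)$. -/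

import Mathlib

open Filter Set Asymptotics

/-- The real digamma function `Ψ(x) = Γ'(x) / Γ(x)`. -/
noncomputable def digammaPsi (x : ℝ) : ℝ :=
  deriv Real.Gamma x / Real.Gamma x

/-- `R(a, b) = -2γ - Ψ(a) - Ψ(b)`, with `γ` the Euler-Mascheroni constant. -/
noncomputable def ramanujanR (a b : ℝ) : ℝ :=
  -2 * Real.eulerMascheroniConstant - digammaPsi a - digammaPsi b

/-- `P(t) = F(a, b; a + b; e^t / (1 + e^t)) * F(a, b; a + b; 1 / (1 + e^t))`, where `F` is the
Gaussian hypergeometric function; both arguments lie in `(0, 1)`, where the series converges. -/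
noncomputable def hypProduct (a b t : ℝ) : ℝ :=
  ordinaryHypergeometric a b (a + b) (Real.exp t / (1 + Real.exp t)) *
    ordinaryHypergeometric a b (a + b) (1 / (1 + Real.exp t))

/-- The difference quotient `G(t) = (P(t) - P(0)) / t` for `t ≠ 0`, completed at `t = 0` by its
limit `P'(0)`. -/
noncomputable def hypSlope (a b t : ℝ) : ℝ :=
  if t = 0 then deriv (hypProduct a b) 0 else (hypProduct a b t - hypProduct a b 0) / t

/-!
Write `F(x) = F(a, b; a + b; x) = ∑ c_n x^n` and `P(t) = F(σ(t)) F(σ(-t))` with the sigmoid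
function `σ(t) = e^t / (1 + e^t)`. The increments of `n c_n` are `a b c_n / (a + b + n)`, so the
hypergeometric equation splits into the first-order system `(1 - x) F' = U`, `x U' = a b F - (a +
b) U`, where `U` is the power series with these coefficients (`hasDerivAt_zeroBalanced`,
`hasDerivAt_companion`). Comparing coefficients gives `0 < U ≤ a b / (a + b) F`.

*Convexity.* Since `σ' = σ (1 - σ)`, the system yields `P'' = σ(t) σ(-t) (2 a b f g + (1 - a - b)
(u g + f v) - 2 u v)`, with `f, u` the values of `F, U` at `σ(t)` and `g, v` those at `σ(-t)`. The
last factor is `f g` times a function affine in each of `u / f` and `v / g`. Both ratios lie in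
`[0, a b / (a + b)]`, and `a b < a + b` makes this function positive at the corners of the square
(`hessianForm_pos`).

*Limits.* As `n c_n` increases to `1 / B` by Euler's limit formula for `Γ`, Abel's theorem gives
`U → 1 / B` at `1`, hence `P'(t) → 1 / B` at `+∞`. It also reduces `B F(x) + log (1 - x) → R` to
`∑_{n < N} B c_n - log N → R + γ`. For `a = 1` one has `B c_n = 1 / (b + n)`, and this is Gauss's
formula for `ψ(b)`. In general these partial sums decrease in `a`, and replacing `a` by `a + 1`
lowers them by `B N c_N / a → 1 / a`; comparing `a + k` with `1 + k` for large `k` therefore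
reduces `a` to `1`, and the cost `∑ (1 / (a + j) - 1 / (1 + j))` is `-ψ(a) - γ`
(`betaPartialSum_sub_log_tendsto`). It follows that `P(t) - t / B → R / B`.

*Remainders.* From `F(x) ≤ 1 - log (1 - x) / B` one gets `P''(t) = O(t e^{-t})`. Integrating this
bound from `t` to infinity, once for `P'` and once more for `P`, gives both asymptotic expansions
(`abs_sub_le_of_abs_deriv_le`). All other assertions are consequences of the parity of `P`, of
`P'' > 0`, and of the two limits.
-/

open scoped Topology Nat

/-! ### Coefficients -/

/-- The coefficient `(a)_n (b)_n / ((a + b)_n n!)` of the zero-balanced series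
`F(a, b; a + b; x)`. -/
noncomputable def zeroBalancedCoeff (a b : ℝ) (n : ℕ) : ℝ :=
  ordinaryHypergeometricCoefficient a b (a + b) n

theorem Gamma_add_natCast {a : ℝ} (ha : 0 < a) (n : ℕ) :
    Real.Gamma (a + n) = (ascPochhammer ℝ n).eval a * Real.Gamma a := by
  induction n with
  | zero => simp
  | succ n ih =>
    rw [Nat.cast_succ, ← add_assoc, Real.Gamma_add_one (by positivity), ih,
      ascPochhammer_succ_eval]
    ring

theorem eval_ascPochhammer_eq_prod_range (a : ℝ) (n : ℕ) :
    (ascPochhammer ℝ n).eval a = ∏ j ∈ Finset.range n, (a + j) := by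
  induction n with
  | zero => simp
  | succ n ih => rw [ascPochhammer_succ_eval, ih, Finset.prod_range_succ]

theorem zeroBalancedCoeff_zero (a b : ℝ) : zeroBalancedCoeff a b 0 = 1 := by
  simp [zeroBalancedCoeff, ordinaryHypergeometricCoefficient]

theorem zeroBalancedCoeff_pos {a b : ℝ} (ha : 0 < a) (hb : 0 < b) (n : ℕ) :
    0 < zeroBalancedCoeff a b n := by
  have h1 := ascPochhammer_pos n a ha
  have h2 := ascPochhammer_pos n b hb
  have h3 := ascPochhammer_pos n (a + b) (add_pos ha hb)
  unfold zeroBalancedCoeff ordinaryHypergeometricCoefficient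
  positivity

theorem zeroBalancedCoeff_succ {a b : ℝ} (ha : 0 < a) (hb : 0 < b) (n : ℕ) :
    zeroBalancedCoeff a b (n + 1) =
      zeroBalancedCoeff a b n * ((a + n) * (b + n) / ((a + b + n) * (n + 1))) := by
  have h3 := ascPochhammer_pos n (a + b) (add_pos ha hb)
  have h4 : (0 : ℝ) < n ! := by positivity
  simp only [zeroBalancedCoeff, ordinaryHypergeometricCoefficient, ascPochhammer_succ_eval,
    Nat.factorial_succ, Nat.cast_mul, Nat.cast_succ]
  field_simp

/-- The increments of `n c_n` are the coefficients of `(1 - x) F'(x)`. -/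
theorem succ_mul_zeroBalancedCoeff_succ {a b : ℝ} (ha : 0 < a) (hb : 0 < b) (n : ℕ) :
    ((n : ℝ) + 1) * zeroBalancedCoeff a b (n + 1) =
      n * zeroBalancedCoeff a b n + a * b / (a + b + n) * zeroBalancedCoeff a b n := by
  rw [zeroBalancedCoeff_succ ha hb]
  field_simp
  ring

theorem zeroBalancedCoeff_le_one {a b : ℝ} (ha : 0 < a) (hb : 0 < b) (hab : a * b < a + b)
    (n : ℕ) : zeroBalancedCoeff a b n ≤ 1 := by
  induction n with
  | zero => rw [zeroBalancedCoeff_zero]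
  | succ n ih =>
    rw [zeroBalancedCoeff_succ ha hb]
    refine mul_le_one₀ ih (by positivity) ?_
    rw [div_le_one (by positivity)]
    nlinarith [(n.cast_nonneg : (0 : ℝ) ≤ n)]

theorem natCast_mul_zeroBalancedCoeff_tendsto {a b : ℝ} (ha : 0 < a) (hb : 0 < b) :
    Tendsto (fun n : ℕ => n * zeroBalancedCoeff a b n) atTop
      (𝓝 (1 / ProbabilityTheory.beta a b)) := by
  rw [← tendsto_add_atTop_iff_nat 1]
  have hA := Real.Gamma_pos_of_pos ha
  have hB := Real.Gamma_pos_of_pos hb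
  have h := (Real.GammaSeq_tendsto_Gamma (a + b)).div
    ((Real.GammaSeq_tendsto_Gamma a).mul (Real.GammaSeq_tendsto_Gamma b)) (by positivity)
  have e : Real.Gamma (a + b) / (Real.Gamma a * Real.Gamma b) =
      1 / ProbabilityTheory.beta a b := by
    rw [ProbabilityTheory.beta, one_div_div]
  rw [e] at h
  refine h.congr' ?_
  filter_upwards [eventually_gt_atTop 0] with n hn
  have hn' : (0 : ℝ) < n := by exact_mod_cast hn
  have h1 := ascPochhammer_pos (n + 1) a ha
  have h2 := ascPochhammer_pos (n + 1) b hb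
  have h3 := ascPochhammer_pos (n + 1) (a + b) (add_pos ha hb)
  have h4 : (0 : ℝ) < n ! := by positivity
  have h5 : (0 : ℝ) < (n : ℝ) ^ a := by positivity
  have h6 : (0 : ℝ) < (n : ℝ) ^ b := by positivity
  simp only [Pi.div_apply, Real.GammaSeq, ← eval_ascPochhammer_eq_prod_range, zeroBalancedCoeff,
    ordinaryHypergeometricCoefficient, Nat.factorial_succ, Nat.cast_mul, Nat.cast_succ,
    Real.rpow_add hn']
  field_simp

theorem natCast_mul_zeroBalancedCoeff_le {a b : ℝ} (ha : 0 < a) (hb : 0 < b) (n : ℕ) :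
    n * zeroBalancedCoeff a b n ≤ 1 / ProbabilityTheory.beta a b := by
  refine Monotone.ge_of_tendsto (monotone_nat_of_le_succ fun k => ?_)
    (natCast_mul_zeroBalancedCoeff_tendsto ha hb) n
  have := zeroBalancedCoeff_pos ha hb k
  rw [Nat.cast_succ, succ_mul_zeroBalancedCoeff_succ ha hb]
  exact le_add_of_nonneg_right (by positivity)

theorem beta_mul_zeroBalancedCoeff {a b : ℝ} (ha : 0 < a) (hb : 0 < b) (n : ℕ) :
    ProbabilityTheory.beta a b * zeroBalancedCoeff a b n =
      Real.Gamma (a + n) / Real.Gamma (a + n + b) * (Real.Gamma (b + n) / n !) := by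
  have h3 := ascPochhammer_pos n (a + b) (add_pos ha hb)
  have h4 := Real.Gamma_pos_of_pos (add_pos ha hb)
  rw [show a + n + b = a + b + n by ring, Gamma_add_natCast ha, Gamma_add_natCast hb,
    Gamma_add_natCast (add_pos ha hb)]
  simp only [ProbabilityTheory.beta, zeroBalancedCoeff, ordinaryHypergeometricCoefficient]
  field_simp

/-! ### The digamma function -/

theorem differentiableAt_log_Gamma {x : ℝ} (hx : 0 < x) :
    DifferentiableAt ℝ (Real.log ∘ Real.Gamma) x :=
  (Real.differentiableAt_Gamma fun m => by
    have : (0 : ℝ) ≤ m := m.cast_nonneg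
    linarith).log (Real.Gamma_pos_of_pos hx).ne'

theorem deriv_log_Gamma {x : ℝ} (hx : 0 < x) :
    deriv (Real.log ∘ Real.Gamma) x = digammaPsi x := by
  have hd : DifferentiableAt ℝ Real.Gamma x := Real.differentiableAt_Gamma fun m => by
    have : (0 : ℝ) ≤ m := m.cast_nonneg
    linarith
  rw [Function.comp_def, deriv.log hd (Real.Gamma_pos_of_pos hx).ne', digammaPsi]

theorem log_Gamma_add_one {x : ℝ} (hx : 0 < x) :
    (Real.log ∘ Real.Gamma) (x + 1) = (Real.log ∘ Real.Gamma) x + Real.log x := by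
  simp only [Function.comp_apply, Real.Gamma_add_one hx.ne',
    Real.log_mul hx.ne' (Real.Gamma_pos_of_pos hx).ne', add_comm]

theorem digammaPsi_add_one {x : ℝ} (hx : 0 < x) :
    digammaPsi (x + 1) = digammaPsi x + 1 / x := by
  rw [← deriv_log_Gamma hx, ← deriv_log_Gamma (by positivity : 0 < x + 1),
    ← deriv_comp_add_const, one_div, ← Real.deriv_log,
    ← deriv_add (differentiableAt_log_Gamma hx) (Real.differentiableAt_log hx.ne')]
  apply EventuallyEq.deriv_eq
  filter_upwards [eventually_gt_nhds hx] with y hy using log_Gamma_add_one hy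

theorem digammaPsi_add_natCast {x : ℝ} (hx : 0 < x) (n : ℕ) :
    digammaPsi (x + n) = digammaPsi x + ∑ j ∈ Finset.range n, 1 / (x + j) := by
  induction n with
  | zero => simp
  | succ n ih =>
    rw [Nat.cast_succ, ← add_assoc, digammaPsi_add_one (by positivity), ih,
      Finset.sum_range_succ, add_assoc]

theorem digammaPsi_le_log {x : ℝ} (hx : 0 < x) : digammaPsi x ≤ Real.log x := by
  have h := Real.convexOn_log_Gamma.deriv_le_slope (mem_Ioi.2 hx)
    (mem_Ioi.2 (by positivity : 0 < x + 1)) (by linarith) (differentiableAt_log_Gamma hx)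
  rwa [deriv_log_Gamma hx, slope_def_field, log_Gamma_add_one hx, add_sub_cancel_left,
    add_sub_cancel_left, div_one] at h

theorem log_le_digammaPsi_add_one {x : ℝ} (hx : 0 < x) : Real.log x ≤ digammaPsi (x + 1) := by
  have h := Real.convexOn_log_Gamma.slope_le_deriv (mem_Ioi.2 hx)
    (mem_Ioi.2 (by positivity : 0 < x + 1)) (by linarith)
    (differentiableAt_log_Gamma (by positivity))
  rwa [deriv_log_Gamma (by positivity), slope_def_field, log_Gamma_add_one hx,
    add_sub_cancel_left, add_sub_cancel_left, div_one] at h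

theorem digammaPsi_one : digammaPsi 1 = -Real.eulerMascheroniConstant := by
  rw [digammaPsi, Real.eulerMascheroniConstant_eq_neg_deriv, Real.Gamma_one]
  ring

/-- Gauss's limit formula for the digamma function. It follows from
`ψ(x) = ψ(x + n) - ∑_{j < n} 1 / (x + j)`, because log-convexity of `Γ` confines `ψ(y)` to the
interval `[log y - 1 / y, log y]`. -/
theorem sum_one_div_add_sub_log_tendsto {x : ℝ} (hx : 0 < x) :
    Tendsto (fun n : ℕ => ∑ j ∈ Finset.range n, 1 / (x + j) - Real.log n) atTop
      (𝓝 (-digammaPsi x)) := by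
  have hlog : Tendsto (fun n : ℕ => Real.log (n + x) - Real.log n) atTop (𝓝 0) :=
    (Real.tendsto_log_comp_add_sub_log x).comp tendsto_natCast_atTop_atTop
  have hinv : Tendsto (fun n : ℕ => 1 / ((n : ℝ) + x)) atTop (𝓝 0) :=
    tendsto_const_nhds.div_atTop
      (tendsto_atTop_add_const_right _ _ tendsto_natCast_atTop_atTop)
  have hlow := (hlog.sub hinv).sub_const (digammaPsi x)
  have hup := hlog.sub_const (digammaPsi x)
  rw [sub_zero, zero_sub] at hlow
  rw [zero_sub] at hup
  refine tendsto_of_tendsto_of_tendsto_of_le_of_le hlow hup (fun n => ?_) fun n => ?_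
  · have h1 := log_le_digammaPsi_add_one (by positivity : 0 < x + n)
    rw [digammaPsi_add_one (by positivity), digammaPsi_add_natCast hx, add_comm x] at h1
    simp only
    linarith
  · have h1 := digammaPsi_le_log (by positivity : 0 < x + n)
    rw [digammaPsi_add_natCast hx, add_comm x] at h1
    simp only
    linarith

/-! ### Partial sums of the series at `1` -/

/-- By log-convexity of `Γ`, the quotient `Γ(x) / Γ(x + b)` decreases in `x`. -/
theorem Gamma_div_Gamma_add_antitone {b x y : ℝ} (hb : 0 < b) (hx : 0 < x) (hxy : x ≤ y) :
    Real.Gamma y / Real.Gamma (y + b) ≤ Real.Gamma x / Real.Gamma (x + b) := by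
  have hy : 0 < y := hx.trans_le hxy
  have mem : ∀ {z : ℝ}, 0 < z → z ∈ Ioi (0 : ℝ) := fun h => h
  have h1 := Real.convexOn_log_Gamma.secant_mono (mem hx) (mem (add_pos hx hb))
    (mem (add_pos hy hb)) (by linarith) (by linarith) (by linarith : x + b ≤ y + b)
  have h2 := Real.convexOn_log_Gamma.secant_mono (mem (add_pos hy hb)) (mem hx)
    (mem hy) (by linarith) (by linarith) hxy
  rw [← neg_div_neg_eq, ← neg_div_neg_eq (_ - _) (y - (y + b)), neg_sub, neg_sub, neg_sub,
    neg_sub, add_sub_cancel_left] at h2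
  rw [add_sub_cancel_left] at h1
  have h3 := h1.trans h2
  rw [div_le_div_iff_of_pos_right hb] at h3
  simp only [Function.comp_apply] at h3
  have g1 := Real.Gamma_pos_of_pos hx
  have g2 := Real.Gamma_pos_of_pos hy
  have g3 := Real.Gamma_pos_of_pos (add_pos hx hb)
  have g4 := Real.Gamma_pos_of_pos (add_pos hy hb)
  rw [← Real.log_le_log_iff (by positivity) (by positivity), Real.log_div g2.ne' g4.ne',
    Real.log_div g1.ne' g3.ne']
  linarith

/-- The `N`-th partial sum of the series `B(a, b) F(a, b; a + b; 1)`. -/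
noncomputable def betaPartialSum (b : ℝ) (N : ℕ) (a : ℝ) : ℝ :=
  ∑ n ∈ Finset.range N, ProbabilityTheory.beta a b * zeroBalancedCoeff a b n

theorem betaPartialSum_antitone {b x y : ℝ} (hb : 0 < b) (hx : 0 < x) (hxy : x ≤ y) (N : ℕ) :
    betaPartialSum b N y ≤ betaPartialSum b N x := by
  refine Finset.sum_le_sum fun n _ => ?_
  have hy : 0 < y := hx.trans_le hxy
  have g : 0 < Real.Gamma (b + n) := Real.Gamma_pos_of_pos (by positivity)
  rw [beta_mul_zeroBalancedCoeff hx hb, beta_mul_zeroBalancedCoeff hy hb]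
  exact mul_le_mul_of_nonneg_right
    (Gamma_div_Gamma_add_antitone hb (by positivity) (by linarith)) (by positivity)

theorem beta_mul_zeroBalancedCoeff_add_one {a b : ℝ} (ha : 0 < a) (hb : 0 < b) (n : ℕ) :
    ProbabilityTheory.beta (a + 1) b * zeroBalancedCoeff (a + 1) b n =
      ProbabilityTheory.beta a b * zeroBalancedCoeff a b n * ((a + n) / (a + b + n)) := by
  have g : 0 < Real.Gamma (a + n + b) := Real.Gamma_pos_of_pos (by positivity)
  rw [beta_mul_zeroBalancedCoeff ha hb, beta_mul_zeroBalancedCoeff (by positivity) hb,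
    show a + 1 + n = a + n + 1 by ring, show a + n + 1 + b = a + n + b + 1 by ring,
    Real.Gamma_add_one (by positivity), Real.Gamma_add_one (by positivity),
    show a + b + n = a + n + b by ring]
  field_simp

theorem betaPartialSum_add_one {a b : ℝ} (ha : 0 < a) (hb : 0 < b) (N : ℕ) :
    betaPartialSum b N (a + 1) = betaPartialSum b N a -
      ProbabilityTheory.beta a b * (N * zeroBalancedCoeff a b N) / a := by
  induction N with
  | zero => simp [betaPartialSum]
  | succ N ih =>
    unfold betaPartialSum at ih ⊢
    rw [Finset.sum_range_succ, Finset.sum_range_succ, ih,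
      beta_mul_zeroBalancedCoeff_add_one ha hb, Nat.cast_succ,
      succ_mul_zeroBalancedCoeff_succ ha hb]
    field_simp
    ring

theorem betaPartialSum_add_natCast {a b : ℝ} (ha : 0 < a) (hb : 0 < b) (N k : ℕ) :
    betaPartialSum b N (a + k) = betaPartialSum b N a - ∑ j ∈ Finset.range k,
      ProbabilityTheory.beta (a + j) b * (N * zeroBalancedCoeff (a + j) b N) / (a + j) := by
  induction k with
  | zero => simp
  | succ k ih =>
    rw [Nat.cast_succ, ← add_assoc, betaPartialSum_add_one (by positivity) hb, ih,
      Finset.sum_range_succ]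
    ring

theorem beta_mul_natCast_mul_zeroBalancedCoeff_le {a b : ℝ} (ha : 0 < a) (hb : 0 < b) (n : ℕ) :
    ProbabilityTheory.beta a b * (n * zeroBalancedCoeff a b n) ≤ 1 := by
  have h := natCast_mul_zeroBalancedCoeff_le ha hb n
  rwa [le_div_iff₀' (ProbabilityTheory.beta_pos ha hb)] at h

theorem sum_shift_tendsto {a b : ℝ} (ha : 0 < a) (hb : 0 < b) (k : ℕ) :
    Tendsto (fun N : ℕ => ∑ j ∈ Finset.range k,
      ProbabilityTheory.beta (a + j) b * (N * zeroBalancedCoeff (a + j) b N) / (a + j)) atTop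
      (𝓝 (∑ j ∈ Finset.range k, 1 / (a + j))) := by
  refine tendsto_finsetSum _ fun j _ => Tendsto.div_const ?_ _
  have ha' : 0 < a + j := by positivity
  have h := (natCast_mul_zeroBalancedCoeff_tendsto ha' hb).const_mul
    (ProbabilityTheory.beta (a + j) b)
  rwa [mul_one_div_cancel (ProbabilityTheory.beta_pos ha' hb).ne'] at h

theorem betaPartialSum_one {b : ℝ} (hb : 0 < b) (N : ℕ) :
    betaPartialSum b N 1 = ∑ j ∈ Finset.range N, 1 / (b + j) := by
  refine Finset.sum_congr rfl fun n _ => ?_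
  have g : 0 < Real.Gamma (b + n) := Real.Gamma_pos_of_pos (by positivity)
  rw [beta_mul_zeroBalancedCoeff one_pos hb, show (1 : ℝ) + n + b = b + n + 1 by ring,
    Real.Gamma_add_one (by positivity), add_comm (1 : ℝ), Real.Gamma_nat_eq_factorial]
  field_simp

/-- Far shifts of the parameter are nearly independent of its fractional part: for `m ≥ a`, both
`betaPartialSum b N (a + (k + 1))` and `betaPartialSum b N (1 + (k + 1))` lie between the values at
`k + 1` and `k + 1 + (m + 1)`, which differ by at most `(m + 1) / (k + 1)`. -/
theorem abs_betaPartialSum_add_sub_le {a b : ℝ} (ha : 0 < a) (hb : 0 < b) {m : ℕ}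
    (hm : a ≤ m) (N k : ℕ) :
    |betaPartialSum b N (a + (k + 1 : ℕ)) - betaPartialSum b N (1 + (k + 1 : ℕ))| ≤
      (m + 1) / (k + 1) := by
  have hm0 : (0 : ℝ) ≤ m := m.cast_nonneg
  have hk : (0 : ℝ) < (k + 1 : ℕ) := by positivity
  have h1 := betaPartialSum_antitone hb hk (by linarith : ((k + 1 : ℕ) : ℝ) ≤ a + (k + 1 : ℕ)) N
  have h2 := betaPartialSum_antitone hb hk (by linarith : ((k + 1 : ℕ) : ℝ) ≤ 1 + (k + 1 : ℕ)) N
  have h3 := betaPartialSum_antitone hb (by positivity : 0 < a + (k + 1 : ℕ))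
    (by push_cast; linarith : a + (k + 1 : ℕ) ≤ ((k + 1 : ℕ) : ℝ) + (m + 1 : ℕ)) N
  have h4 := betaPartialSum_antitone hb (by positivity : 0 < (1 : ℝ) + (k + 1 : ℕ))
    (by push_cast; linarith : (1 : ℝ) + (k + 1 : ℕ) ≤ ((k + 1 : ℕ) : ℝ) + (m + 1 : ℕ)) N
  have h5 := betaPartialSum_add_natCast hk hb N (m + 1)
  have h6 : ∑ j ∈ Finset.range (m + 1), ProbabilityTheory.beta (((k + 1 : ℕ) : ℝ) + j) b *
      (N * zeroBalancedCoeff (((k + 1 : ℕ) : ℝ) + j) b N) / (((k + 1 : ℕ) : ℝ) + j) ≤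
      (m + 1) / (k + 1) := by
    calc _ ≤ ∑ j ∈ Finset.range (m + 1), 1 / ((k : ℝ) + 1) := by
          refine Finset.sum_le_sum fun j _ => ?_
          refine div_le_div₀ zero_le_one
            (beta_mul_natCast_mul_zeroBalancedCoeff_le (by positivity) hb N) (by positivity) ?_
          push_cast
          linarith [(j.cast_nonneg : (0 : ℝ) ≤ j)]
      _ = _ := by
          rw [Finset.sum_const, Finset.card_range, nsmul_eq_mul]
          push_cast
          ring
  rw [abs_le]
  constructor <;> linarith

/-- The partial sums of `B(a, b) F(a, b; a + b; 1)` grow like `log N`, with the explicit constant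
`-ψ(a) - ψ(b) - γ`. For `a = 1` this is Gauss's formula for `ψ(b)`; the general case is reached by
shifting `a` and `1` to infinity, each unit step costing `1 / a` in the limit. -/
theorem betaPartialSum_sub_log_tendsto {a b : ℝ} (ha : 0 < a) (hb : 0 < b) :
    Tendsto (fun N : ℕ => betaPartialSum b N a - Real.log N) atTop
      (𝓝 (ramanujanR a b + Real.eulerMascheroniConstant)) := by
  obtain ⟨m, hm⟩ := exists_nat_ge a
  have hdiff : Tendsto (fun N : ℕ => betaPartialSum b N a - betaPartialSum b N 1) atTop
      (𝓝 (-digammaPsi a - Real.eulerMascheroniConstant)) := by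
    rw [Metric.tendsto_atTop]
    intro ε hε
    have hk1 : Tendsto (fun k : ℕ => ∑ j ∈ Finset.range k, 1 / (a + j) -
        ∑ j ∈ Finset.range k, 1 / ((1 : ℝ) + j)) atTop
        (𝓝 (-digammaPsi a - Real.eulerMascheroniConstant)) := by
      have h := (sum_one_div_add_sub_log_tendsto ha).sub
        (sum_one_div_add_sub_log_tendsto one_pos)
      rw [digammaPsi_one, neg_neg] at h
      exact h.congr fun k => by ring
    have hk2 : Tendsto (fun k : ℕ => ((m : ℝ) + 1) / (k + 1)) atTop (𝓝 0) :=
      tendsto_const_nhds.div_atTop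
        (tendsto_atTop_add_const_right _ _ tendsto_natCast_atTop_atTop)
    obtain ⟨k, hk, hk'⟩ := (((hk1.comp (tendsto_add_atTop_nat 1)).eventually
      (Metric.ball_mem_nhds _ (by positivity : 0 < ε / 3))).and
      (hk2.eventually (gt_mem_nhds (by positivity : 0 < ε / 3)))).exists
    have hN := (sum_shift_tendsto ha hb (k + 1)).sub (sum_shift_tendsto one_pos hb (k + 1))
    obtain ⟨N₀, hN₀⟩ := (Metric.tendsto_atTop.1 hN) (ε / 3) (by positivity)
    refine ⟨N₀, fun N hle => ?_⟩
    have e1 := hN₀ N hle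
    have e2 := abs_betaPartialSum_add_sub_le ha hb hm N k
    rw [betaPartialSum_add_natCast ha hb, betaPartialSum_add_natCast one_pos hb] at e2
    simp only [Function.comp_apply, Real.dist_eq] at hk e1 ⊢
    rw [abs_lt] at hk e1 ⊢
    rw [abs_le] at e2
    constructor <;> linarith
  have h := hdiff.add (sum_one_div_add_sub_log_tendsto hb)
  have e : -digammaPsi a - Real.eulerMascheroniConstant + -digammaPsi b =
      ramanujanR a b + Real.eulerMascheroniConstant := by
    rw [ramanujanR]; ring
  rw [e] at h
  refine h.congr fun N => ?_
  rw [← betaPartialSum_one hb]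
  ring

/-! ### Power series with bounded coefficients -/

theorem summable_mul_pow_of_bounded {c : ℕ → ℝ} {M x : ℝ} (hc : ∀ n, |c n| ≤ M)
    (hx : |x| < 1) : Summable fun n => c n * x ^ n := by
  refine Summable.of_norm_bounded ((summable_geometric_of_lt_one (abs_nonneg x) hx).mul_left M)
    fun n => ?_
  rw [norm_mul, norm_pow, Real.norm_eq_abs, Real.norm_eq_abs]
  exact mul_le_mul_of_nonneg_right (hc n) (by positivity)

theorem summable_natCast_mul_mul_pow {c : ℕ → ℝ} {M x : ℝ} (hc : ∀ n, |c n| ≤ M)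
    (hx : |x| < 1) : Summable fun n : ℕ => n * c n * x ^ n := by
  have h := (summable_pow_mul_geometric_of_norm_lt_one 1
    (by rwa [Real.norm_eq_abs, abs_abs] : ‖|x|‖ < 1)).mul_left M
  refine Summable.of_norm_bounded h fun n => ?_
  rw [norm_mul, norm_mul, norm_pow, Real.norm_eq_abs, Real.norm_eq_abs, Real.norm_eq_abs,
    pow_one, Nat.abs_cast, mul_comm (n : ℝ), mul_assoc]
  exact mul_le_mul_of_nonneg_right (hc n) (by positivity)

theorem summable_succ_mul_succ_mul_pow {c : ℕ → ℝ} {M x : ℝ} (hc : ∀ n, |c n| ≤ M)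
    (hx : |x| < 1) : Summable fun n : ℕ => ((n : ℝ) + 1) * c (n + 1) * x ^ n := by
  have hc' : ∀ n, |c (n + 1)| ≤ M := fun n => hc (n + 1)
  refine ((summable_natCast_mul_mul_pow hc' hx).add
    (summable_mul_pow_of_bounded hc' hx)).congr fun n => ?_
  ring

theorem mul_tsum_succ_mul_succ_mul_pow {c : ℕ → ℝ} {M x : ℝ} (hc : ∀ n, |c n| ≤ M)
    (hx : |x| < 1) : x * ∑' n : ℕ, ((n : ℝ) + 1) * c (n + 1) * x ^ n =
      ∑' n : ℕ, n * c n * x ^ n := by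
  rw [(summable_natCast_mul_mul_pow hc hx).tsum_eq_zero_add, ← tsum_mul_left, Nat.cast_zero,
    zero_mul, zero_mul, zero_add]
  refine tsum_congr fun n => ?_
  push_cast
  ring

theorem hasDerivAt_tsum_mul_pow {c : ℕ → ℝ} {M x : ℝ} (hc : ∀ n, |c n| ≤ M) (hx : |x| < 1) :
    HasDerivAt (fun y => ∑' n, c n * y ^ n) (∑' n : ℕ, ((n : ℝ) + 1) * c (n + 1) * x ^ n) x := by
  obtain ⟨r, hxr, hr⟩ := exists_between hx
  have hr0 : 0 < r := (abs_nonneg x).trans_lt hxr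
  have hM : 0 ≤ M := (abs_nonneg _).trans (hc 0)
  have hsum : Summable fun n : ℕ => M * (n * r ^ (n - 1)) := by
    refine Summable.mul_left M ?_
    rw [← summable_nat_add_iff 1]
    have h := summable_succ_mul_succ_mul_pow (c := fun _ => 1) (M := 1) (x := r)
      (fun n => by simp) (by rwa [abs_of_pos hr0])
    refine h.congr fun n => ?_
    push_cast
    simp
  have h := hasDerivAt_tsum_of_isPreconnected (g := fun n y => c n * y ^ n)
    (g' := fun n y => c n * (n * y ^ (n - 1))) (t := Ioo (-r) r) (y₀ := 0) hsum isOpen_Ioo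
    isPreconnected_Ioo (fun n y _ => (hasDerivAt_pow n y).const_mul (c n)) (fun n y hy => ?_)
    ⟨by linarith, hr0⟩ (summable_mul_pow_of_bounded hc (by simp)) (abs_lt.1 hxr)
  · convert! h using 1
    have hs : Summable fun n : ℕ => c n * (n * x ^ (n - 1)) := by
      rw [← summable_nat_add_iff 1]
      refine (summable_succ_mul_succ_mul_pow hc hx).congr fun n => ?_
      rw [Nat.cast_succ, Nat.add_sub_cancel]
      ring
    rw [hs.tsum_eq_zero_add]
    simp only [Nat.cast_zero, zero_mul, mul_zero, zero_add]
    refine tsum_congr fun n => ?_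
    rw [Nat.cast_succ, Nat.add_sub_cancel]
    ring
  · rw [norm_mul, norm_mul, norm_pow, Real.norm_eq_abs, Real.norm_eq_abs, Real.norm_eq_abs,
      Nat.abs_cast]
    have : |y| ≤ r := abs_le.2 ⟨hy.1.le, hy.2.le⟩
    gcongr
    exact hc n

/-! ### The zero-balanced hypergeometric function on `[0, 1)` -/

/-- The power series of `F(a, b; a + b; x)`. -/
noncomputable def zeroBalanced (a b x : ℝ) : ℝ := ∑' n, zeroBalancedCoeff a b n * x ^ n

/-- The coefficients of `(1 - x) F'(x)` for `F(x) = F(a, b; a + b; x)`. -/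
noncomputable def companionCoeff (a b : ℝ) (n : ℕ) : ℝ :=
  a * b / (a + b + n) * zeroBalancedCoeff a b n

/-- The function `U(x) = (1 - x) F'(x)` for `F(x) = F(a, b; a + b; x)`, defined by its power series.
It is `a b / (a + b) F(a, b; a + b + 1; x)`. -/
noncomputable def companion (a b x : ℝ) : ℝ := ∑' n, companionCoeff a b n * x ^ n

theorem ordinaryHypergeometric_eq_zeroBalanced (a b x : ℝ) :
    ordinaryHypergeometric a b (a + b) x = zeroBalanced a b x := by
  rw [ordinaryHypergeometric_eq_tsum]
  rfl

section

variable {a b : ℝ}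

theorem companionCoeff_pos (ha : 0 < a) (hb : 0 < b) (n : ℕ) : 0 < companionCoeff a b n := by
  have := zeroBalancedCoeff_pos ha hb n
  unfold companionCoeff
  positivity

theorem companionCoeff_le (ha : 0 < a) (hb : 0 < b) (n : ℕ) :
    companionCoeff a b n ≤ a * b / (a + b) * zeroBalancedCoeff a b n := by
  have := zeroBalancedCoeff_pos ha hb n
  have h : a + b ≤ a + b + n := le_add_of_nonneg_right n.cast_nonneg
  unfold companionCoeff
  gcongr

theorem abs_zeroBalancedCoeff_le_one (ha : 0 < a) (hb : 0 < b) (hab : a * b < a + b) (n : ℕ) :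
    |zeroBalancedCoeff a b n| ≤ 1 := by
  rw [abs_of_pos (zeroBalancedCoeff_pos ha hb n)]
  exact zeroBalancedCoeff_le_one ha hb hab n

theorem abs_companionCoeff_le_one (ha : 0 < a) (hb : 0 < b) (hab : a * b < a + b) (n : ℕ) :
    |companionCoeff a b n| ≤ 1 := by
  rw [abs_of_pos (companionCoeff_pos ha hb n)]
  refine (companionCoeff_le ha hb n).trans (mul_le_one₀ ?_ (zeroBalancedCoeff_pos ha hb n).le
    (zeroBalancedCoeff_le_one ha hb hab n))
  rw [div_le_one (by positivity)]
  exact hab.le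

theorem abs_lt_one_of_mem {x : ℝ} (h0 : 0 ≤ x) (h1 : x < 1) : |x| < 1 := by
  rwa [abs_of_nonneg h0]

theorem one_le_zeroBalanced (ha : 0 < a) (hb : 0 < b) (hab : a * b < a + b) {x : ℝ}
    (h0 : 0 ≤ x) (h1 : x < 1) : 1 ≤ zeroBalanced a b x := by
  have h := (summable_mul_pow_of_bounded (abs_zeroBalancedCoeff_le_one ha hb hab)
    (abs_lt_one_of_mem h0 h1)).le_tsum 0
    fun n _ => mul_nonneg (zeroBalancedCoeff_pos ha hb n).le (pow_nonneg h0 n)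
  rwa [zeroBalancedCoeff_zero, pow_zero, one_mul] at h

theorem companion_pos (ha : 0 < a) (hb : 0 < b) (hab : a * b < a + b) {x : ℝ}
    (h0 : 0 ≤ x) (h1 : x < 1) : 0 < companion a b x := by
  refine (summable_mul_pow_of_bounded (abs_companionCoeff_le_one ha hb hab)
    (abs_lt_one_of_mem h0 h1)).tsum_pos
    (fun n => mul_nonneg (companionCoeff_pos ha hb n).le (pow_nonneg h0 n)) 0 ?_
  rw [pow_zero, mul_one]
  exact companionCoeff_pos ha hb 0

theorem companion_le (ha : 0 < a) (hb : 0 < b) (hab : a * b < a + b) {x : ℝ}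
    (h0 : 0 ≤ x) (h1 : x < 1) : companion a b x ≤ a * b / (a + b) * zeroBalanced a b x := by
  rw [zeroBalanced, ← tsum_mul_left]
  refine Summable.tsum_le_tsum (fun n => ?_)
    (summable_mul_pow_of_bounded (abs_companionCoeff_le_one ha hb hab) (abs_lt_one_of_mem h0 h1))
    ((summable_mul_pow_of_bounded (abs_zeroBalancedCoeff_le_one ha hb hab)
      (abs_lt_one_of_mem h0 h1)).mul_left _)
  rw [← mul_assoc]
  exact mul_le_mul_of_nonneg_right (companionCoeff_le ha hb n) (pow_nonneg h0 n)

theorem hasDerivAt_zeroBalanced (ha : 0 < a) (hb : 0 < b) (hab : a * b < a + b) {x : ℝ}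
    (h0 : 0 ≤ x) (h1 : x < 1) :
    HasDerivAt (zeroBalanced a b) (companion a b x / (1 - x)) x := by
  have hx := abs_lt_one_of_mem h0 h1
  have hc := abs_zeroBalancedCoeff_le_one ha hb hab
  convert! hasDerivAt_tsum_mul_pow hc hx using 1
  rw [div_eq_iff (by linarith : 1 - x ≠ 0), mul_comm, sub_mul, one_mul,
    mul_tsum_succ_mul_succ_mul_pow hc hx,
    ← (summable_succ_mul_succ_mul_pow hc hx).tsum_sub (summable_natCast_mul_mul_pow hc hx),
    companion]
  refine tsum_congr fun n => ?_
  rw [succ_mul_zeroBalancedCoeff_succ ha hb, companionCoeff]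
  ring

/-- Together with `hasDerivAt_zeroBalanced` this is the hypergeometric differential equation,
written as the first-order system `(1 - x) F' = U`, `x U' = a b F - (a + b) U`. -/
theorem hasDerivAt_companion (ha : 0 < a) (hb : 0 < b) (hab : a * b < a + b) {x : ℝ}
    (h0 : 0 < x) (h1 : x < 1) :
    HasDerivAt (companion a b)
      ((a * b * zeroBalanced a b x - (a + b) * companion a b x) / x) x := by
  have hx := abs_lt_one_of_mem h0.le h1
  have hc := abs_companionCoeff_le_one ha hb hab
  have hc' := abs_zeroBalancedCoeff_le_one ha hb hab
  convert! hasDerivAt_tsum_mul_pow hc hx using 1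
  rw [div_eq_iff h0.ne', mul_comm _ x, mul_tsum_succ_mul_succ_mul_pow hc hx, zeroBalanced,
    companion, ← tsum_mul_left, ← tsum_mul_left,
    ← ((summable_mul_pow_of_bounded hc' hx).mul_left _).tsum_sub
      ((summable_mul_pow_of_bounded hc hx).mul_left _)]
  refine tsum_congr fun n => ?_
  rw [companionCoeff]
  field_simp
  ring

theorem zeroBalanced_le (ha : 0 < a) (hb : 0 < b) (hab : a * b < a + b) {x : ℝ}
    (h0 : 0 ≤ x) (h1 : x < 1) :
    zeroBalanced a b x ≤ 1 - Real.log (1 - x) / ProbabilityTheory.beta a b := by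
  have hx := abs_lt_one_of_mem h0 h1
  have hs := summable_mul_pow_of_bounded (abs_zeroBalancedCoeff_le_one ha hb hab) hx
  have hl := (Real.hasSum_pow_div_log_of_abs_lt_one hx).mul_left
    (1 / ProbabilityTheory.beta a b)
  rw [zeroBalanced, hs.tsum_eq_zero_add, zeroBalancedCoeff_zero, pow_zero, mul_one, sub_eq_add_neg,
    ← neg_div, ← one_div_mul_eq_div, ← hl.tsum_eq]
  refine add_le_add_right (Summable.tsum_le_tsum (fun n => ?_) ((summable_nat_add_iff 1).2 hs)
    hl.summable) _
  have h := natCast_mul_zeroBalancedCoeff_le ha hb (n + 1)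
  rw [Nat.cast_succ] at h
  calc zeroBalancedCoeff a b (n + 1) * x ^ (n + 1)
      = (n + 1) * zeroBalancedCoeff a b (n + 1) * (x ^ (n + 1) / (n + 1)) := by
        field_simp
    _ ≤ _ := mul_le_mul_of_nonneg_right h (by positivity)

theorem companion_tendsto (ha : 0 < a) (hb : 0 < b) :
    Tendsto (companion a b) (𝓝[<] 1) (𝓝 (1 / ProbabilityTheory.beta a b)) := by
  refine Real.tendsto_tsum_powerSeries_nhdsWithin_lt
    ((natCast_mul_zeroBalancedCoeff_tendsto ha hb).congr fun n => ?_)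
  induction n with
  | zero => simp
  | succ n ih =>
    rw [Finset.sum_range_succ, ← ih, Nat.cast_succ, succ_mul_zeroBalancedCoeff_succ ha hb,
      companionCoeff]

/-- Ramanujan's asymptotic formula for the zero-balanced hypergeometric function at `1`. -/
theorem zeroBalanced_add_log_tendsto (ha : 0 < a) (hb : 0 < b) (hab : a * b < a + b) :
    Tendsto (fun x => zeroBalanced a b x + Real.log (1 - x) / ProbabilityTheory.beta a b)
      (𝓝[<] 1) (𝓝 (ramanujanR a b / ProbabilityTheory.beta a b)) := by
  have hB := ProbabilityTheory.beta_pos ha hb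
  -- For `n = 0` the subtracted term `1 / 0 / B` vanishes by convention, as it should.
  have hsum : Tendsto (fun N => ∑ n ∈ Finset.range N,
      (zeroBalancedCoeff a b n - 1 / n / ProbabilityTheory.beta a b)) atTop
      (𝓝 (ramanujanR a b / ProbabilityTheory.beta a b)) := by
    rw [← tendsto_add_atTop_iff_nat 1]
    have h := (((betaPartialSum_sub_log_tendsto ha hb).comp (tendsto_add_atTop_nat 1)).sub
      Real.tendsto_harmonic_sub_log_add_one).div_const (ProbabilityTheory.beta a b)
    rw [add_sub_cancel_right] at h
    refine h.congr fun N => ?_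
    have e : ∑ n ∈ Finset.range (N + 1), (1 : ℝ) / n = harmonic N := by
      rw [Finset.sum_range_succ', harmonic]
      push_cast
      simp
    rw [Finset.sum_sub_distrib, ← Finset.sum_div, e]
    simp only [Function.comp_apply, betaPartialSum, ← Finset.mul_sum]
    push_cast
    field_simp
    ring
  refine (Real.tendsto_tsum_powerSeries_nhdsWithin_lt hsum).congr' ?_
  filter_upwards [Ioo_mem_nhdsLT (zero_lt_one' ℝ)] with x hx
  have hx' := abs_lt_one_of_mem hx.1.le hx.2
  have hs := summable_mul_pow_of_bounded (abs_zeroBalancedCoeff_le_one ha hb hab) hx'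
  have hl := (Real.hasSum_pow_div_log_of_abs_lt_one hx').div_const (ProbabilityTheory.beta a b)
  have hl' : HasSum (fun n : ℕ => (1 : ℝ) / n / ProbabilityTheory.beta a b * x ^ n)
      (-Real.log (1 - x) / ProbabilityTheory.beta a b) := by
    rw [← hasSum_nat_add_iff' 1]
    simp only [Finset.range_one, Finset.sum_singleton, Nat.cast_zero, div_zero, zero_div,
      zero_mul, sub_zero]
    refine hl.congr_fun fun n => ?_
    push_cast
    ring
  simp only [sub_mul]
  rw [hs.tsum_sub hl'.summable, hl'.tsum_eq, zeroBalanced]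
  ring

end

/-! ### The product in the variable `t` -/

section

variable {a b : ℝ}

theorem exp_div_one_add_exp (t : ℝ) : Real.exp t / (1 + Real.exp t) = Real.sigmoid t := by
  rw [Real.sigmoid_def, Real.exp_neg]
  field_simp
  ring

theorem one_div_one_add_exp (t : ℝ) : 1 / (1 + Real.exp t) = Real.sigmoid (-t) := by
  rw [Real.sigmoid_def, neg_neg, one_div]

theorem hypProduct_eq (a b t : ℝ) : hypProduct a b t =
    zeroBalanced a b (Real.sigmoid t) * zeroBalanced a b (Real.sigmoid (-t)) := by
  rw [hypProduct, exp_div_one_add_exp, one_div_one_add_exp,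
    ordinaryHypergeometric_eq_zeroBalanced, ordinaryHypergeometric_eq_zeroBalanced]

theorem hypProduct_neg (a b t : ℝ) : hypProduct a b (-t) = hypProduct a b t := by
  rw [hypProduct_eq, hypProduct_eq, neg_neg, mul_comm]

theorem hasDerivAt_zeroBalanced_sigmoid (ha : 0 < a) (hb : 0 < b) (hab : a * b < a + b) (t : ℝ) :
    HasDerivAt (fun t => zeroBalanced a b (Real.sigmoid t))
      (Real.sigmoid t * companion a b (Real.sigmoid t)) t := by
  have h := (hasDerivAt_zeroBalanced ha hb hab (Real.sigmoid_pos t).le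
    (Real.sigmoid_lt_one t)).comp t (Real.hasDerivAt_sigmoid t)
  convert! h using 1
  have : 1 - Real.sigmoid t ≠ 0 := by linarith [Real.sigmoid_lt_one t]
  field_simp

theorem hasDerivAt_companion_sigmoid (ha : 0 < a) (hb : 0 < b) (hab : a * b < a + b) (t : ℝ) :
    HasDerivAt (fun t => companion a b (Real.sigmoid t))
      ((1 - Real.sigmoid t) * (a * b * zeroBalanced a b (Real.sigmoid t) -
        (a + b) * companion a b (Real.sigmoid t))) t := by
  have h := (hasDerivAt_companion ha hb hab (Real.sigmoid_pos t)
    (Real.sigmoid_lt_one t)).comp t (Real.hasDerivAt_sigmoid t)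
  convert! h using 1
  have := (Real.sigmoid_pos t).ne'
  field_simp

/-- The half `σ(t) U(σ(t)) F(σ(-t))` of the derivative of the product, `σ` being the sigmoid
function; the other half is its reflection. -/
noncomputable def halfDeriv (a b t : ℝ) : ℝ :=
  Real.sigmoid t * companion a b (Real.sigmoid t) * zeroBalanced a b (Real.sigmoid (-t))

theorem hasDerivAt_hypProduct (ha : 0 < a) (hb : 0 < b) (hab : a * b < a + b) (t : ℝ) :
    HasDerivAt (hypProduct a b) (halfDeriv a b t - halfDeriv a b (-t)) t := by
  rw [show hypProduct a b = _ from funext (hypProduct_eq a b)]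
  have h := (hasDerivAt_zeroBalanced_sigmoid ha hb hab t).mul
    ((hasDerivAt_zeroBalanced_sigmoid ha hb hab (-t)).scomp t (hasDerivAt_neg t))
  convert! h using 1
  simp only [halfDeriv, neg_neg, Function.comp_apply, smul_eq_mul]
  ring

/-- The factor of `P''(t)` besides `σ(t) σ(-t)`, as a function of the values `f, u` of `F, U` at
`σ(t)` and `g, v` of `F, U` at `σ(-t)`. -/
noncomputable def hessianForm (a b f u g v : ℝ) : ℝ :=
  2 * (a * b) * (f * g) + (1 - (a + b)) * (u * g + f * v) - 2 * (u * v)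

/-- Writing `u = p f`, `v = q g`, the form is `f g` times a function affine in `p` and in `q`, which
is positive at the corners of the square `[0, m]²` with `m = a b / (a + b) < 1`. -/
theorem hessianForm_pos (ha : 0 < a) (hb : 0 < b) (hab : a * b < a + b) {f u g v : ℝ}
    (hu : 0 < u) (hv : 0 < v) (huf : u ≤ a * b / (a + b) * f)
    (hvg : v ≤ a * b / (a + b) * g) : 0 < hessianForm a b f u g v := by
  have hs : 0 < a + b := by positivity
  obtain ⟨m, hm⟩ : ∃ m, m = a * b / (a + b) := ⟨_, rfl⟩
  have hm0 : 0 < m := hm ▸ by positivity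
  have hm1 : m < 1 := by rw [hm, div_lt_one hs]; exact hab
  have hms : a * b = m * (a + b) := by rw [hm]; field_simp
  rw [← hm] at huf hvg
  rw [hessianForm, hms]
  -- The form is `m⁻²` times the combination of its four corner values with the bilinear weights.
  have key : m ^ 2 * (2 * (m * (a + b)) * (f * g) + (1 - (a + b)) * (u * g + f * v) - 2 * (u * v)) =
      2 * m * (a + b) * ((m * f - u) * (m * g - v)) +
      m * (1 + (a + b)) * (u * (m * g - v) + v * (m * f - u)) + 2 * m * (1 - m) * (u * v) := by
    ring
  have h1 : 0 ≤ (m * f - u) * (m * g - v) := mul_nonneg (by linarith) (by linarith)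
  have h2 : 0 ≤ u * (m * g - v) := mul_nonneg hu.le (by linarith)
  have h3 : 0 ≤ v * (m * f - u) := mul_nonneg hv.le (by linarith)
  have h4 : 0 < 2 * m * (1 - m) * (u * v) :=
    mul_pos (mul_pos (by positivity) (by linarith)) (by positivity)
  have h5 : 0 < m ^ 2 *
      (2 * (m * (a + b)) * (f * g) + (1 - (a + b)) * (u * g + f * v) - 2 * (u * v)) := by
    rw [key]
    positivity
  exact pos_of_mul_pos_right h5 (by positivity)

theorem hasDerivAt_halfDeriv (ha : 0 < a) (hb : 0 < b) (hab : a * b < a + b) (t : ℝ) :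
    HasDerivAt (halfDeriv a b) (Real.sigmoid t * Real.sigmoid (-t) *
      (((1 - (a + b)) * companion a b (Real.sigmoid t) +
        a * b * zeroBalanced a b (Real.sigmoid t)) * zeroBalanced a b (Real.sigmoid (-t)) -
        companion a b (Real.sigmoid t) * companion a b (Real.sigmoid (-t)))) t := by
  have h := ((Real.hasDerivAt_sigmoid t).mul (hasDerivAt_companion_sigmoid ha hb hab t)).mul
    ((hasDerivAt_zeroBalanced_sigmoid ha hb hab (-t)).scomp t (hasDerivAt_neg t))
  convert! h using 1
  simp only [Function.comp_apply, smul_eq_mul, Real.sigmoid_neg, Pi.mul_apply]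
  ring

theorem deriv_hypProduct (ha : 0 < a) (hb : 0 < b) (hab : a * b < a + b) :
    deriv (hypProduct a b) = fun t => halfDeriv a b t - halfDeriv a b (-t) :=
  funext fun t => (hasDerivAt_hypProduct ha hb hab t).deriv

theorem hasDerivAt_deriv_hypProduct (ha : 0 < a) (hb : 0 < b) (hab : a * b < a + b) (t : ℝ) :
    HasDerivAt (deriv (hypProduct a b)) (Real.sigmoid t * Real.sigmoid (-t) *
      hessianForm a b (zeroBalanced a b (Real.sigmoid t)) (companion a b (Real.sigmoid t))
        (zeroBalanced a b (Real.sigmoid (-t))) (companion a b (Real.sigmoid (-t)))) t := by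
  rw [deriv_hypProduct ha hb hab]
  have h := (hasDerivAt_halfDeriv ha hb hab t).sub
    ((hasDerivAt_halfDeriv ha hb hab (-t)).scomp t (hasDerivAt_neg t))
  convert! h using 1
  simp only [smul_eq_mul, neg_neg, hessianForm]
  ring

theorem deriv_deriv_hypProduct_pos (ha : 0 < a) (hb : 0 < b) (hab : a * b < a + b) (t : ℝ) :
    0 < deriv (deriv (hypProduct a b)) t := by
  rw [(hasDerivAt_deriv_hypProduct ha hb hab t).deriv]
  have h' := fun t => companion_pos ha hb hab (Real.sigmoid_pos t).le (Real.sigmoid_lt_one t)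
  have h'' := fun t => companion_le ha hb hab (Real.sigmoid_pos t).le (Real.sigmoid_lt_one t)
  exact mul_pos (mul_pos (Real.sigmoid_pos t) (Real.sigmoid_pos (-t)))
    (hessianForm_pos ha hb hab (h' t) (h' (-t)) (h'' t) (h'' (-t)))

/-! ### Behaviour at infinity -/

theorem log_one_sub_sigmoid (t : ℝ) :
    Real.log (1 - Real.sigmoid t) = -Real.log (1 + Real.exp t) := by
  rw [← Real.sigmoid_neg, Real.sigmoid_def, neg_neg, Real.log_inv]

theorem sigmoid_neg_le_exp_neg (t : ℝ) : Real.sigmoid (-t) ≤ Real.exp (-t) := by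
  rw [← Real.sigmoid_mul_rexp_neg]
  exact mul_le_of_le_one_left (Real.exp_pos _).le (Real.sigmoid_le_one t)

theorem log_one_add_exp (t : ℝ) :
    Real.log (1 + Real.exp t) = t + Real.log (1 + Real.exp (-t)) := by
  have h : 1 + Real.exp t = Real.exp t * (1 + Real.exp (-t)) := by
    rw [mul_add, ← Real.exp_add, add_neg_cancel, Real.exp_zero, mul_one, add_comm]
  rw [h, Real.log_mul (Real.exp_pos t).ne' (by positivity), Real.log_exp]

theorem log_one_add_exp_neg_le (t : ℝ) : Real.log (1 + Real.exp (-t)) ≤ Real.exp (-t) := by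
  have := Real.log_le_sub_one_of_pos (by positivity : 0 < 1 + Real.exp (-t))
  linarith

theorem zeroBalanced_sigmoid_le (ha : 0 < a) (hb : 0 < b) (hab : a * b < a + b) (t : ℝ) :
    zeroBalanced a b (Real.sigmoid t) ≤
      1 + Real.log (1 + Real.exp t) / ProbabilityTheory.beta a b := by
  have h := zeroBalanced_le ha hb hab (Real.sigmoid_pos t).le (Real.sigmoid_lt_one t)
  rwa [log_one_sub_sigmoid, neg_div, sub_neg_eq_add] at h

theorem zeroBalanced_sigmoid_neg_le (ha : 0 < a) (hb : 0 < b) (hab : a * b < a + b) (t : ℝ) :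
    zeroBalanced a b (Real.sigmoid (-t)) ≤
      1 + Real.exp (-t) / ProbabilityTheory.beta a b := by
  refine (zeroBalanced_sigmoid_le ha hb hab (-t)).trans ?_
  have := log_one_add_exp_neg_le t
  have := ProbabilityTheory.beta_pos ha hb
  gcongr

theorem exists_hypProduct_le (ha : 0 < a) (hb : 0 < b) (hab : a * b < a + b) :
    ∃ K, 0 < K ∧ ∀ t, 1 ≤ t → hypProduct a b t ≤ K * t := by
  have hB := ProbabilityTheory.beta_pos ha hb
  refine ⟨(1 + 2 / ProbabilityTheory.beta a b) * (1 + 1 / ProbabilityTheory.beta a b),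
    by positivity, fun t ht => ?_⟩
  have he : Real.exp (-t) ≤ 1 := Real.exp_le_one_iff.2 (by linarith)
  have h1 := zeroBalanced_sigmoid_le ha hb hab t
  have h2 := zeroBalanced_sigmoid_neg_le ha hb hab t
  have h3 := log_one_add_exp_neg_le t
  rw [log_one_add_exp] at h1
  have h4 : 1 + (t + Real.log (1 + Real.exp (-t))) / ProbabilityTheory.beta a b ≤
      (1 + 2 / ProbabilityTheory.beta a b) * t := by
    have : (t + Real.log (1 + Real.exp (-t))) / ProbabilityTheory.beta a b ≤
        2 * t / ProbabilityTheory.beta a b := by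
      gcongr
      linarith
    calc _ ≤ t + 2 * t / ProbabilityTheory.beta a b := add_le_add ht this
      _ = _ := by ring
  have h5 : 1 + Real.exp (-t) / ProbabilityTheory.beta a b ≤
      1 + 1 / ProbabilityTheory.beta a b := by gcongr
  have h6 := one_le_zeroBalanced ha hb hab (Real.sigmoid_pos (-t)).le (Real.sigmoid_lt_one (-t))
  rw [hypProduct_eq, mul_right_comm]
  exact mul_le_mul (h1.trans h4) (h2.trans h5) (by linarith) (by positivity)

theorem companion_le_zeroBalanced (ha : 0 < a) (hb : 0 < b) (hab : a * b < a + b) {x : ℝ}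
    (h0 : 0 ≤ x) (h1 : x < 1) : companion a b x ≤ zeroBalanced a b x := by
  have h := one_le_zeroBalanced ha hb hab h0 h1
  refine (companion_le ha hb hab h0 h1).trans (mul_le_of_le_one_left (by linarith) ?_)
  rw [div_le_one (by positivity)]
  exact hab.le

theorem hessianForm_le (ha : 0 < a) (hb : 0 < b) {f u g v : ℝ}
    (hu : 0 < u) (hv : 0 < v) (huf : u ≤ f) (hvg : v ≤ g) :
    hessianForm a b f u g v ≤ 2 * (a * b + 1) * (f * g) := by
  have h1 : u * g ≤ f * g := mul_le_mul_of_nonneg_right huf (hv.le.trans hvg)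
  have h2 : f * v ≤ f * g := mul_le_mul_of_nonneg_left hvg (hu.le.trans huf)
  have h3 : 0 < u * g := mul_pos hu (hv.trans_le hvg)
  have h4 : 0 < f * v := mul_pos (hu.trans_le huf) hv
  have h5 : 0 < u * v := mul_pos hu hv
  have h6 : 0 < (a + b) * (u * g + f * v) := by positivity
  rw [hessianForm]
  linarith

/-- The second derivative decays like `t e^{-t}`. -/
theorem exists_deriv_deriv_hypProduct_le (ha : 0 < a) (hb : 0 < b) (hab : a * b < a + b) :
    ∃ K, 0 < K ∧ ∀ t, 1 ≤ t → deriv (deriv (hypProduct a b)) t ≤ K * (t * Real.exp (-t)) := by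
  obtain ⟨K, hK, h⟩ := exists_hypProduct_le ha hb hab
  refine ⟨2 * (a * b + 1) * K, by positivity, fun t ht => ?_⟩
  have hσ := fun t => (Real.sigmoid_pos t).le
  have hσ' := Real.sigmoid_lt_one
  have h1 := hessianForm_le ha hb (companion_pos ha hb hab (hσ t) (hσ' t))
    (companion_pos ha hb hab (hσ (-t)) (hσ' (-t)))
    (companion_le_zeroBalanced ha hb hab (hσ t) (hσ' t))
    (companion_le_zeroBalanced ha hb hab (hσ (-t)) (hσ' (-t)))
  rw [← hypProduct_eq] at h1
  have h2 : Real.sigmoid t * Real.sigmoid (-t) ≤ Real.exp (-t) :=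
    (mul_le_of_le_one_left (hσ _) (hσ' t).le).trans (sigmoid_neg_le_exp_neg t)
  rw [(hasDerivAt_deriv_hypProduct ha hb hab t).deriv]
  calc _ ≤ Real.sigmoid t * Real.sigmoid (-t) * (2 * (a * b + 1) * (K * t)) := by
        refine mul_le_mul_of_nonneg_left (h1.trans ?_) (mul_nonneg (hσ _) (hσ _))
        exact mul_le_mul_of_nonneg_left (h t ht) (by positivity)
    _ ≤ Real.exp (-t) * (2 * (a * b + 1) * (K * t)) :=
        mul_le_mul_of_nonneg_right h2 (by positivity)
    _ = _ := by ring

theorem tendsto_sigmoid_nhdsLT_one : Tendsto Real.sigmoid atTop (𝓝[<] 1) :=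
  tendsto_nhdsWithin_iff.2 ⟨Real.tendsto_sigmoid_atTop,
    Eventually.of_forall Real.sigmoid_lt_one⟩

theorem tendsto_exp_neg_atTop : Tendsto (fun t : ℝ => Real.exp (-t)) atTop (𝓝 0) :=
  Real.tendsto_exp_neg_atTop_nhds_zero

theorem tendsto_mul_exp_neg_atTop : Tendsto (fun t : ℝ => t * Real.exp (-t)) atTop (𝓝 0) := by
  simpa using Real.tendsto_pow_mul_exp_neg_atTop_nhds_zero 1

theorem zeroBalanced_sigmoid_neg_tendsto (ha : 0 < a) (hb : 0 < b) (hab : a * b < a + b) :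
    Tendsto (fun t => zeroBalanced a b (Real.sigmoid (-t))) atTop (𝓝 1) := by
  have h : Tendsto (fun t : ℝ => 1 + Real.exp (-t) / ProbabilityTheory.beta a b) atTop (𝓝 1) := by
    simpa using (tendsto_exp_neg_atTop.div_const (ProbabilityTheory.beta a b)).const_add 1
  exact tendsto_of_tendsto_of_tendsto_of_le_of_le tendsto_const_nhds h
    (fun t => one_le_zeroBalanced ha hb hab (Real.sigmoid_pos _).le (Real.sigmoid_lt_one _))
    (zeroBalanced_sigmoid_neg_le ha hb hab)

theorem deriv_hypProduct_tendsto (ha : 0 < a) (hb : 0 < b) (hab : a * b < a + b) :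
    Tendsto (deriv (hypProduct a b)) atTop (𝓝 (1 / ProbabilityTheory.beta a b)) := by
  have h1 : Tendsto (halfDeriv a b) atTop (𝓝 (1 / ProbabilityTheory.beta a b)) := by
    have h := (Real.tendsto_sigmoid_atTop.mul
      ((companion_tendsto ha hb).comp tendsto_sigmoid_nhdsLT_one)).mul
      (zeroBalanced_sigmoid_neg_tendsto ha hb hab)
    rwa [one_mul, mul_one] at h
  have h2 : Tendsto (fun t => halfDeriv a b (-t)) atTop (𝓝 0) := by
    obtain ⟨K, hK, h⟩ := exists_hypProduct_le ha hb hab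
    have hσ := fun t => (Real.sigmoid_pos t).le
    have hσ' := Real.sigmoid_lt_one
    have hlim := tendsto_mul_exp_neg_atTop.const_mul K
    rw [mul_zero] at hlim
    refine squeeze_zero' (Eventually.of_forall fun t => ?_) ?_ hlim
    · have := companion_pos ha hb hab (hσ (-t)) (hσ' (-t))
      have := one_le_zeroBalanced ha hb hab (hσ (- -t)) (hσ' (- -t))
      have := hσ (-t)
      unfold halfDeriv
      positivity
    · filter_upwards [eventually_ge_atTop 1] with t ht
      have h3 := h t ht
      have h4 := one_le_zeroBalanced ha hb hab (hσ t) (hσ' t)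
      rw [hypProduct_eq] at h3
      calc halfDeriv a b (-t) ≤ Real.sigmoid (-t) * zeroBalanced a b (Real.sigmoid (-t)) *
            zeroBalanced a b (Real.sigmoid t) := by
            rw [halfDeriv, neg_neg]
            exact mul_le_mul_of_nonneg_right (mul_le_mul_of_nonneg_left
              (companion_le_zeroBalanced ha hb hab (hσ _) (hσ' _)) (hσ _)) (by linarith)
        _ = Real.sigmoid (-t) * (zeroBalanced a b (Real.sigmoid t) *
            zeroBalanced a b (Real.sigmoid (-t))) := by ring
        _ ≤ Real.exp (-t) * (K * t) := by
            refine mul_le_mul (sigmoid_neg_le_exp_neg t) h3 ?_ (Real.exp_pos _).le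
            have h5 := one_le_zeroBalanced ha hb hab (hσ (-t)) (hσ' (-t))
            positivity
        _ = _ := by ring
  have h := h1.sub h2
  rw [sub_zero] at h
  rwa [deriv_hypProduct ha hb hab]

theorem hypProduct_sub_tendsto (ha : 0 < a) (hb : 0 < b) (hab : a * b < a + b) :
    Tendsto (fun t => hypProduct a b t - t / ProbabilityTheory.beta a b) atTop
      (𝓝 (ramanujanR a b / ProbabilityTheory.beta a b)) := by
  have hB := ProbabilityTheory.beta_pos ha hb
  have hlog : Tendsto (fun t : ℝ => Real.log (1 + Real.exp (-t)) / ProbabilityTheory.beta a b)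
      atTop (𝓝 0) := by
    have h : Tendsto (fun t : ℝ => Real.log (1 + Real.exp (-t))) atTop (𝓝 0) :=
      squeeze_zero (fun t => Real.log_nonneg (by linarith [Real.exp_pos (-t)]))
        log_one_add_exp_neg_le tendsto_exp_neg_atTop
    simpa using h.div_const (ProbabilityTheory.beta a b)
  have h1 : Tendsto (fun t => zeroBalanced a b (Real.sigmoid t) -
      t / ProbabilityTheory.beta a b) atTop
      (𝓝 (ramanujanR a b / ProbabilityTheory.beta a b)) := by
    have h := ((zeroBalanced_add_log_tendsto ha hb hab).comp tendsto_sigmoid_nhdsLT_one).add hlog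
    rw [add_zero] at h
    refine h.congr fun t => ?_
    rw [Function.comp_apply, log_one_sub_sigmoid, log_one_add_exp]
    ring
  have h2 : Tendsto (fun t => t * (zeroBalanced a b (Real.sigmoid (-t)) - 1)) atTop (𝓝 0) := by
    have hlim := tendsto_mul_exp_neg_atTop.div_const (ProbabilityTheory.beta a b)
    rw [zero_div] at hlim
    refine squeeze_zero' ?_ ?_ hlim
    · filter_upwards [eventually_ge_atTop 0] with t ht
      have := one_le_zeroBalanced ha hb hab (Real.sigmoid_pos (-t)).le (Real.sigmoid_lt_one (-t))
      exact mul_nonneg ht (by linarith)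
    · filter_upwards [eventually_ge_atTop 0] with t ht
      have := zeroBalanced_sigmoid_neg_le ha hb hab t
      rw [mul_div_assoc]
      exact mul_le_mul_of_nonneg_left (by linarith) ht
  have h := (h1.mul (zeroBalanced_sigmoid_neg_tendsto ha hb hab)).add
    (h2.div_const (ProbabilityTheory.beta a b))
  rw [mul_one, zero_div, add_zero] at h
  refine h.congr fun t => ?_
  rw [hypProduct_eq]
  ring

end

/-! ### Remainder estimates -/

/-- Integrating the bound `K t e^{-t}` on the derivative from `t` to infinity: both `g` and `-g`
decrease on `[1, ∞)` after addition of `K (t + 1) e^{-t}`. -/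
theorem abs_sub_le_of_abs_deriv_le {g g' : ℝ → ℝ} {K L : ℝ} (hg : ∀ t, HasDerivAt g (g' t) t)
    (hK : ∀ t, 1 ≤ t → |g' t| ≤ K * (t * Real.exp (-t))) (hL : Tendsto g atTop (𝓝 L)) {t : ℝ}
    (ht : 1 ≤ t) : |g t - L| ≤ 2 * K * (t * Real.exp (-t)) := by
  have hK0 : 0 ≤ K := by
    have h := (abs_nonneg _).trans (hK 1 le_rfl)
    rw [one_mul] at h
    exact nonneg_of_mul_nonneg_left h (Real.exp_pos _)
  have hE : ∀ s : ℝ, HasDerivAt (fun s => K * ((s + 1) * Real.exp (-s)))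
      (-(K * (s * Real.exp (-s)))) s := fun s => by
    have h := (((hasDerivAt_id s).add_const 1).mul (hasDerivAt_neg s).exp).const_mul K
    convert! h using 1
    simp only [id]
    ring
  have hElim : Tendsto (fun s : ℝ => K * ((s + 1) * Real.exp (-s))) atTop (𝓝 0) := by
    have h := (tendsto_mul_exp_neg_atTop.add tendsto_exp_neg_atTop).const_mul K
    rw [add_zero, mul_zero] at h
    exact h.congr fun s => by ring
  have key : ∀ {q q' : ℝ → ℝ} {M : ℝ}, (∀ s, HasDerivAt q (q' s) s) →
      (∀ s, 1 ≤ s → q' s ≤ K * (s * Real.exp (-s))) → Tendsto q atTop (𝓝 M) →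
      M ≤ q t + K * ((t + 1) * Real.exp (-t)) := fun {q q' M} hq hq' hM => by
    have hd := fun s => (hq s).add (hE s)
    have hanti : AntitoneOn (q + fun s => K * ((s + 1) * Real.exp (-s))) (Ici 1) := by
      refine antitoneOn_of_deriv_nonpos (convex_Ici 1)
        (fun s _ => (hd s).continuousAt.continuousWithinAt)
        (fun s _ => (hd s).differentiableAt.differentiableWithinAt) fun s hs => ?_
      rw [interior_Ici] at hs
      rw [(hd s).deriv]
      linarith [hq' s hs.le]
    have hlim := hM.add hElim
    rw [add_zero] at hlim
    refine le_of_tendsto hlim ?_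
    filter_upwards [eventually_ge_atTop t] with s hs
    exact hanti ht (ht.trans hs) hs
  have h1 := key hg (fun s hs => (le_abs_self _).trans (hK s hs)) hL
  have h2 := key (fun s => (hg s).neg) (fun s hs => (neg_le_abs _).trans (hK s hs)) hL.neg
  have h3 : K * ((t + 1) * Real.exp (-t)) ≤ 2 * K * (t * Real.exp (-t)) := by
    have : K * ((t + 1) * Real.exp (-t)) ≤ K * ((t + t) * Real.exp (-t)) := by gcongr
    linarith
  simp only [Pi.neg_apply] at h2
  rw [abs_le]
  constructor <;> linarith

theorem isBigO_mul_exp_neg_abs {g : ℝ → ℝ} {K : ℝ}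
    (h : ∀ t, 1 ≤ t → |g t| ≤ K * (t * Real.exp (-t))) :
    g =O[atTop] fun t => t * Real.exp (-|t|) := by
  refine IsBigO.of_bound K ?_
  filter_upwards [eventually_ge_atTop 1] with t ht
  have ht0 : 0 ≤ t := zero_le_one.trans ht
  rw [abs_of_nonneg ht0, Real.norm_eq_abs, Real.norm_of_nonneg (by positivity)]
  exact h t ht

/-- A remainder that is even or odd has the same order at `-∞` as at `+∞`. -/
theorem isBigO_atBot_of_abs_neg_eq {g : ℝ → ℝ} (hg : ∀ t, |g (-t)| = |g t|)
    (h : g =O[atTop] fun t => t * Real.exp (-|t|)) :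
    g =O[atBot] fun t => t * Real.exp (-|t|) := by
  have h' := h.comp_tendsto tendsto_neg_atBot_atTop
  refine (IsBigO.of_bound 1 (Eventually.of_forall fun t => ?_)).trans
    (h'.trans (IsBigO.of_bound 1 (Eventually.of_forall fun t => ?_)))
  · rw [one_mul, Function.comp_apply, Real.norm_eq_abs, Real.norm_eq_abs, hg]
  · rw [one_mul, Function.comp_apply, abs_neg, neg_mul, norm_neg]

theorem isGLB_range_of_tendsto {g : ℝ → ℝ} {l : Filter ℝ} [l.NeBot] {m : ℝ}
    (hlow : ∀ t, m ≤ g t) (h : Tendsto g l (𝓝 m)) : IsGLB (range g) m :=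
  isGLB_of_mem_closure (by rintro _ ⟨t, rfl⟩; exact hlow t)
    (mem_closure_of_tendsto h (Eventually.of_forall mem_range_self))

theorem isLUB_range_of_tendsto {g : ℝ → ℝ} {l : Filter ℝ} [l.NeBot] {m : ℝ}
    (hup : ∀ t, g t ≤ m) (h : Tendsto g l (𝓝 m)) : IsLUB (range g) m :=
  isLUB_of_mem_closure (by rintro _ ⟨t, rfl⟩; exact hup t)
    (mem_closure_of_tendsto h (Eventually.of_forall mem_range_self))

/-! ### Even functions with increasing derivative -/

section

variable {f : ℝ → ℝ} {l : ℝ}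

theorem deriv_neg_of_even (heven : ∀ t, f (-t) = f t) (t : ℝ) : deriv f (-t) = -deriv f t := by
  have h := deriv_comp_neg f t
  rw [show (fun x => f (-x)) = f from funext heven] at h
  rw [h, neg_neg]

theorem deriv_zero_of_even (heven : ∀ t, f (-t) = f t) : deriv f 0 = 0 := by
  have h := deriv_neg_of_even heven 0
  rw [neg_zero] at h
  linarith

theorem tendsto_atBot_of_odd {g : ℝ → ℝ} (hodd : ∀ t, g (-t) = -g t)
    (hl : Tendsto g atTop (𝓝 l)) : Tendsto g atBot (𝓝 (-l)) :=
  (hl.comp tendsto_neg_atBot_atTop).neg.congr fun t => by simp [hodd]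

theorem StrictMono.lt_of_tendsto_atTop {g : ℝ → ℝ} (hg : StrictMono g)
    (hl : Tendsto g atTop (𝓝 l)) (t : ℝ) : g t < l :=
  (hg (lt_add_one t)).trans_le (hg.monotone.ge_of_tendsto hl (t + 1))

theorem StrictMono.mem_Ioo_of_odd {g : ℝ → ℝ} (hg : StrictMono g) (hodd : ∀ t, g (-t) = -g t)
    (hl : Tendsto g atTop (𝓝 l)) (t : ℝ) : -l < g t ∧ g t < l := by
  have h := hg.lt_of_tendsto_atTop hl (-t)
  rw [hodd] at h
  exact ⟨by linarith, hg.lt_of_tendsto_atTop hl t⟩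

/-- The difference quotient at `0` of a function with strictly increasing derivative is strictly
increasing: away from `0` by strict convexity, across `0` by the mean value theorem. -/
theorem strictMono_dslope_zero (hd : Differentiable ℝ f) (hm : StrictMono (deriv f)) :
    StrictMono (dslope f 0) := by
  have hconv : StrictConvexOn ℝ univ f := hm.strictConvexOn_univ_of_deriv hd.continuous
  have hpos : ∀ t, 0 < t → dslope f 0 0 < dslope f 0 t := fun t ht => by
    obtain ⟨ξ, hξ, he⟩ := exists_deriv_eq_slope f ht hd.continuous.continuousOn
      hd.differentiableOn
    rw [dslope_same, dslope_of_ne f ht.ne', slope_def_field, ← he]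
    exact hm hξ.1
  have hneg : ∀ t, t < 0 → dslope f 0 t < dslope f 0 0 := fun t ht => by
    obtain ⟨ξ, hξ, he⟩ := exists_deriv_eq_slope f ht hd.continuous.continuousOn
      hd.differentiableOn
    rw [dslope_same, dslope_of_ne f ht.ne, slope_comm, slope_def_field, ← he]
    exact hm hξ.2
  intro x y hxy
  rcases eq_or_ne x 0 with rfl | hx
  · exact hpos y hxy
  rcases eq_or_ne y 0 with rfl | hy
  · exact hneg x hxy
  rw [dslope_of_ne f hx, dslope_of_ne f hy, slope_def_field, slope_def_field]
  exact hconv.secant_strict_mono (mem_univ 0) (mem_univ x) (mem_univ y) hx hy hxy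

theorem dslope_zero_neg (heven : ∀ t, f (-t) = f t) (t : ℝ) :
    dslope f 0 (-t) = -dslope f 0 t := by
  rcases eq_or_ne t 0 with rfl | ht
  · rw [neg_zero, dslope_same, deriv_zero_of_even heven, neg_zero]
  · rw [dslope_of_ne f (neg_ne_zero.2 ht), dslope_of_ne f ht, slope_def_field, slope_def_field,
      heven, sub_zero, sub_zero, div_neg]

theorem continuous_dslope_zero (hd : Differentiable ℝ f) : Continuous (dslope f 0) := by
  refine continuous_iff_continuousAt.2 fun t => ?_
  rcases eq_or_ne t 0 with rfl | ht
  · exact continuousAt_dslope_same.2 (hd 0)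
  · exact (continuousAt_dslope_of_ne ht).2 (hd t).continuousAt

theorem dslope_zero_tendsto {r : ℝ} (h : Tendsto (fun t => f t - t * l) atTop (𝓝 r)) :
    Tendsto (dslope f 0) atTop (𝓝 l) := by
  have h1 := ((h.sub_const (f 0)).div_atTop tendsto_id).add_const l
  rw [zero_add] at h1
  refine h1.congr' ?_
  filter_upwards [eventually_gt_atTop 0] with t ht
  rw [dslope_of_ne f ht.ne', slope_def_field, id]
  field_simp
  ring

theorem range_eq_Ioo_of_odd {g : ℝ → ℝ} (hc : Continuous g) (hg : StrictMono g)
    (hodd : ∀ t, g (-t) = -g t) (hl : Tendsto g atTop (𝓝 l)) : range g = Ioo (-l) l := by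
  refine Subset.antisymm ?_ fun y hy => ?_
  · rintro _ ⟨t, rfl⟩
    exact hg.mem_Ioo_of_odd hodd hl t
  · obtain ⟨s, hs⟩ := ((tendsto_atBot_of_odd hodd hl).eventually_lt_const hy.1).exists
    obtain ⟨t, ht⟩ := (hl.eventually_const_lt hy.2).exists
    exact mem_range_of_exists_le_of_exists_ge hc ⟨s, hs.le⟩ ⟨t, ht.le⟩

end

theorem hypSlope_eq_dslope (a b : ℝ) : hypSlope a b = dslope (hypProduct a b) 0 := by
  funext t
  rcases eq_or_ne t 0 with rfl | ht
  · rw [hypSlope, if_pos rfl, dslope_same]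
  · rw [hypSlope, if_neg ht, dslope_of_ne _ ht, slope_def_field, sub_zero]

/-! ### Properties of the product -/

theorem mainTheorem2 (a b : ℝ) (ha : 0 < a) (hb : 0 < b) (hab : a * b < a + b) :
    -- (1) parity, monotonicity, convexity and asymptotics of P
    ((∀ t : ℝ, hypProduct a b (-t) = hypProduct a b t) ∧
      StrictAntiOn (hypProduct a b) (Iic 0) ∧
      StrictMonoOn (hypProduct a b) (Ici 0) ∧
      Differentiable ℝ (hypProduct a b) ∧
      Differentiable ℝ (deriv (hypProduct a b)) ∧
      (∀ t : ℝ, 0 < deriv (deriv (hypProduct a b)) t) ∧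
      StrictConvexOn ℝ univ (hypProduct a b) ∧
      (fun t : ℝ => hypProduct a b t - (|t| + ramanujanR a b) / ProbabilityTheory.beta a b)
        =O[atTop] (fun t : ℝ => t * Real.exp (-|t|)) ∧
      (fun t : ℝ => hypProduct a b t - (|t| + ramanujanR a b) / ProbabilityTheory.beta a b)
        =O[atBot] (fun t : ℝ => t * Real.exp (-|t|))) ∧
    -- (2) parity, monotonicity, asymptotics and sharp bounds of P'
    ((∀ t : ℝ, deriv (hypProduct a b) (-t) = -deriv (hypProduct a b) t) ∧
      StrictMono (deriv (hypProduct a b)) ∧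
      deriv (hypProduct a b) 0 = 0 ∧
      (fun t : ℝ => deriv (hypProduct a b) t - (|t| / t) * (1 / ProbabilityTheory.beta a b))
        =O[atTop] (fun t : ℝ => t * Real.exp (-|t|)) ∧
      (fun t : ℝ => deriv (hypProduct a b) t - (|t| / t) * (1 / ProbabilityTheory.beta a b))
        =O[atBot] (fun t : ℝ => t * Real.exp (-|t|)) ∧
      (∀ t : ℝ, -(1 / ProbabilityTheory.beta a b) < deriv (hypProduct a b) t ∧
        deriv (hypProduct a b) t < 1 / ProbabilityTheory.beta a b) ∧
      IsGLB (range (deriv (hypProduct a b))) (-(1 / ProbabilityTheory.beta a b)) ∧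
      IsLUB (range (deriv (hypProduct a b))) (1 / ProbabilityTheory.beta a b)) ∧
    -- (3) the functions P(t) - t/B and P(t) + t/B, and sharp bounds of P(t) - |t|/B
    (StrictConvexOn ℝ univ (fun t : ℝ => hypProduct a b t - t / ProbabilityTheory.beta a b) ∧
      StrictAnti (fun t : ℝ => hypProduct a b t - t / ProbabilityTheory.beta a b) ∧
      StrictConvexOn ℝ univ (fun t : ℝ => hypProduct a b t + t / ProbabilityTheory.beta a b) ∧
      StrictMono (fun t : ℝ => hypProduct a b t + t / ProbabilityTheory.beta a b) ∧
      (∀ t : ℝ, ramanujanR a b / ProbabilityTheory.beta a b < hypProduct a b t - |t| / ProbabilityTheory.beta a b ∧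
        hypProduct a b t - |t| / ProbabilityTheory.beta a b ≤ hypProduct a b 0) ∧
      IsGLB (range fun t : ℝ => hypProduct a b t - |t| / ProbabilityTheory.beta a b)
        (ramanujanR a b / ProbabilityTheory.beta a b) ∧
      IsLUB (range fun t : ℝ => hypProduct a b t - |t| / ProbabilityTheory.beta a b) (hypProduct a b 0)) ∧
    -- (4) the difference quotient G
    (StrictMono (hypSlope a b) ∧
      range (hypSlope a b) = Ioo (-(1 / ProbabilityTheory.beta a b)) (1 / ProbabilityTheory.beta a b)) := by
  set l : ℝ := 1 / ProbabilityTheory.beta a b with hl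
  have heven := hypProduct_neg a b
  have hodd := deriv_neg_of_even heven
  have hzero := deriv_zero_of_even heven
  have hd : Differentiable ℝ (hypProduct a b) := fun t =>
    (hasDerivAt_hypProduct ha hb hab t).differentiableAt
  have hdd : Differentiable ℝ (deriv (hypProduct a b)) := fun t =>
    (hasDerivAt_deriv_hypProduct ha hb hab t).differentiableAt
  have hpos := deriv_deriv_hypProduct_pos ha hb hab
  have hmono : StrictMono (deriv (hypProduct a b)) := strictMono_of_deriv_pos hpos
  have hconv : StrictConvexOn ℝ univ (hypProduct a b) :=
    hmono.strictConvexOn_univ_of_deriv hd.continuous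
  have hlim := deriv_hypProduct_tendsto ha hb hab
  have hlim' := hypProduct_sub_tendsto ha hb hab
  have hmem := hmono.mem_Ioo_of_odd hodd hlim
  have hsub : ∀ t, HasDerivAt (fun t => hypProduct a b t - t / ProbabilityTheory.beta a b)
      (deriv (hypProduct a b) t - l) t := fun t =>
    (hd t).hasDerivAt.sub ((hasDerivAt_id' t).div_const _)
  have hadd : ∀ t, HasDerivAt (fun t => hypProduct a b t + t / ProbabilityTheory.beta a b)
      (deriv (hypProduct a b) t + l) t := fun t =>
    (hd t).hasDerivAt.add ((hasDerivAt_id' t).div_const _)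
  have hanti : StrictAnti (fun t => hypProduct a b t - t / ProbabilityTheory.beta a b) :=
    strictAnti_of_deriv_neg fun t => by
      rw [(hsub t).deriv]
      linarith [(hmem t).2]
  have hMonoOn : StrictMonoOn (hypProduct a b) (Ici 0) := by
    refine strictMonoOn_of_deriv_pos (convex_Ici 0) hd.continuous.continuousOn fun t ht => ?_
    rw [interior_Ici] at ht
    have h := hmono (mem_Ioi.1 ht)
    rwa [hzero] at h
  -- The remainder of `P'` comes from the bound on `P''`, that of `P` from the one of `P'`.
  obtain ⟨K, -, hbound⟩ := exists_deriv_deriv_hypProduct_le ha hb hab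
  have hbound' : ∀ t, 1 ≤ t →
      |deriv (hypProduct a b) t - l| ≤ 2 * K * (t * Real.exp (-t)) := fun t ht =>
    abs_sub_le_of_abs_deriv_le (fun s => (hdd s).hasDerivAt)
      (fun s hs => by rw [abs_of_pos (hpos s)]; exact hbound s hs) hlim ht
  have hO : (fun t : ℝ => hypProduct a b t - (|t| + ramanujanR a b) / ProbabilityTheory.beta a b)
      =O[atTop] (fun t : ℝ => t * Real.exp (-|t|)) := by
    refine isBigO_mul_exp_neg_abs (K := 2 * (2 * K)) fun t ht => ?_
    rw [abs_of_nonneg (zero_le_one.trans ht), add_div, ← sub_sub]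
    exact abs_sub_le_of_abs_deriv_le hsub hbound' hlim' ht
  have hO' : (fun t : ℝ => deriv (hypProduct a b) t - (|t| / t) * l)
      =O[atTop] (fun t : ℝ => t * Real.exp (-|t|)) := by
    refine isBigO_mul_exp_neg_abs (K := 2 * K) fun t ht => ?_
    have ht0 : 0 < t := zero_lt_one.trans_le ht
    rw [abs_of_pos ht0, div_self ht0.ne', one_mul]
    exact hbound' t ht
  have heven' : ∀ t, hypProduct a b |t| = hypProduct a b t := fun t => by
    rcases abs_choice t with h | h <;> rw [h]
    exact heven t
  have hbd : ∀ t : ℝ, ramanujanR a b / ProbabilityTheory.beta a b <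
      hypProduct a b t - |t| / ProbabilityTheory.beta a b ∧
      hypProduct a b t - |t| / ProbabilityTheory.beta a b ≤ hypProduct a b 0 := fun t => by
    rw [← heven' t]
    refine ⟨(hanti.antitone.le_of_tendsto hlim' (|t| + 1)).trans_lt (hanti (lt_add_one |t|)), ?_⟩
    have h := hanti.antitone (abs_nonneg t)
    simpa using h
  refine ⟨⟨heven, ?_, hMonoOn, hd, hdd, hpos, hconv, hO, ?_⟩,
    ⟨hodd, hmono, hzero, hO', ?_, hmem, ?_, ?_⟩, ⟨?_, hanti, ?_, ?_, hbd, ?_, ?_⟩, ?_, ?_⟩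
  · intro x hx y hy hxy
    rw [← heven x, ← heven y]
    exact hMonoOn (mem_Ici.2 (neg_nonneg.2 hy)) (mem_Ici.2 (neg_nonneg.2 hx)) (neg_lt_neg hxy)
  · exact isBigO_atBot_of_abs_neg_eq (fun t => by rw [heven, abs_neg]) hO
  · refine isBigO_atBot_of_abs_neg_eq (fun t => ?_) hO'
    rw [hodd, abs_neg, div_neg, neg_mul, ← neg_sub', abs_neg]
  · exact isGLB_range_of_tendsto (fun t => (hmem t).1.le) (tendsto_atBot_of_odd hodd hlim)
  · exact isLUB_range_of_tendsto (fun t => (hmem t).2.le) hlim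
  · refine StrictMono.strictConvexOn_univ_of_deriv
      (continuous_iff_continuousAt.2 fun t => (hsub t).continuousAt) ?_
    rw [show deriv _ = _ from funext fun t => (hsub t).deriv]
    exact fun x y hxy => sub_lt_sub_right (hmono hxy) l
  · refine StrictMono.strictConvexOn_univ_of_deriv
      (continuous_iff_continuousAt.2 fun t => (hadd t).continuousAt) ?_
    rw [show deriv _ = _ from funext fun t => (hadd t).deriv]
    exact fun x y hxy => add_lt_add_left (hmono hxy) l
  · refine strictMono_of_deriv_pos fun t => ?_
    rw [(hadd t).deriv]
    linarith [(hmem t).1]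
  · refine isGLB_range_of_tendsto (l := atTop) (fun t => (hbd t).1.le) (hlim'.congr' ?_)
    filter_upwards [eventually_ge_atTop 0] with t ht
    rw [abs_of_nonneg ht]
  -- The supremum is attained at `0`.
  · refine IsGreatest.isLUB ⟨⟨0, by simp⟩, ?_⟩
    rintro _ ⟨t, rfl⟩
    exact (hbd t).2
  · rw [hypSlope_eq_dslope]
    exact strictMono_dslope_zero hd hmono
  · rw [hypSlope_eq_dslope]
    exact range_eq_Ioo_of_odd (continuous_dslope_zero hd) (strictMono_dslope_zero hd hmono)
      (dslope_zero_neg heven)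
      (dslope_zero_tendsto (hlim'.congr fun t => by rw [hl, mul_one_div]))
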